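/- For a topological space $Y$, a point $y\in Y$ and an open cover $\mathcal U$ of $Y$, let $\pi(\mathcal U,y)\le\pi_1(Y,y)$ be the subgroup of all homotopy classes of loops represented by finite products $\prod_{j=1}^{n}u_jv_ju_j^{-1}$, where each $u_j$ is a path in $Y$ starting at $y$ and each $v_j$ is a loop, based at the end point of $u_j$, that lies in some member of $\mathcal U$. The (unbased) Spanier group of $Y$ at $y$ is $\pi_1^{sp}(Y,y)=\bigcap_{\mathcal U}\pi(\mathcal U,y)$, where $\mathcal U$ runs over all open covers of $Y$. The space $Y$ is called a Spanier space if $\pi_1^{sp}(Y,y)=\pi_1(Y,y)$ for every $y\in Y$. Theorem 5.5. Let $X$ be a first countable, simply connected (in particular path connected) and locally path connected space, and let $A\subseteq X$ be a closed, path connected (in particular nonempty) subset. Then the quotient space $X/A$, obtained from $X$ by identifying $A$ to a single point, with the quotient topology, is a Spanier space. -/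

import Mathlib

universe u

/-- The equivalence relation on `X` that identifies all points of `A` with each other and
no other distinct points. -/
def collapseSetoid {X : Type u} (A : Set X) : Setoid X where
  r x y := x = y ∨ (x ∈ A ∧ y ∈ A)
  iseqv :=
    { refl := fun _ => Or.inl rfl
      symm := by
        rintro x y (h | ⟨hx, hy⟩)
        · exact Or.inl h.symm
        · exact Or.inr ⟨hy, hx⟩
      trans := by
        rintro x y z (rfl | ⟨hx, hy⟩) (rfl | ⟨hy', hz⟩)
        · exact Or.inl rfl
        · exact Or.inr ⟨hy', hz⟩
        · exact Or.inr ⟨hx, hy⟩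
        · exact Or.inr ⟨hx, hz⟩ }

/-- The quotient space `X / A`; being an abbreviation for a quotient type, it carries
the quotient topology. -/
abbrev CollapseSpace {X : Type u} (A : Set X) : Type u :=
  Quotient (collapseSetoid A)

section Spanier

variable {X : Type u} [TopologicalSpace X]

/-- `𝒰` is a cover of the space `X` by open sets. -/
def IsCoverByOpens (𝒰 : Set (Set X)) : Prop :=
  (∀ U ∈ 𝒰, IsOpen U) ∧ ⋃₀ 𝒰 = Set.univ

/-- `g` is the class of a loop `u * v * u⁻¹`, where `u` is a path starting at `x` and `v` is
a loop, based at the end point of `u`, that lies in one of the members of `𝒰`. -/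
def IsSpanierGenerator (𝒰 : Set (Set X)) (x : X) (g : FundamentalGroup X x) : Prop :=
  ∃ (y : X) (u : Path x y) (v : Path y y), (∃ U ∈ 𝒰, ∀ t, v t ∈ U) ∧
    g = FundamentalGroup.fromPath (Path.Homotopic.Quotient.mk ((u.trans v).trans u.symm))

theorem IsSpanierGenerator.inv {𝒰 : Set (Set X)} {x : X} {g : FundamentalGroup X x}
    (hg : IsSpanierGenerator 𝒰 x g) : IsSpanierGenerator 𝒰 x g⁻¹ := by
  obtain ⟨y, u, v, ⟨U, hU, hv⟩, rfl⟩ := hg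
  refine ⟨y, u, v.symm, ⟨U, hU, fun t => hv _⟩, ?_⟩
  rw [FundamentalGroup.inv_def]
  change Path.Homotopic.Quotient.symm (Path.Homotopic.Quotient.mk _) =
    Path.Homotopic.Quotient.mk _
  rw [← Path.Homotopic.Quotient.mk_symm, Path.trans_symm, Path.trans_symm, Path.symm_symm,
    Path.Homotopic.Quotient.eq]
  exact ⟨(Path.Homotopy.transAssoc u v.symm u.symm).symm⟩

/-- The (unbased) Spanier group `π(𝒰, x)` with respect to `𝒰`: the subgroup of `π₁(X, x)` of all
finite products of classes of loops `uⱼ * vⱼ * uⱼ⁻¹` as in `IsSpanierGenerator`. -/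
noncomputable def spanierSubgroup (𝒰 : Set (Set X)) (x : X) : Subgroup (FundamentalGroup X x) where
  carrier := {g | ∃ l : List (FundamentalGroup X x),
    (∀ h ∈ l, IsSpanierGenerator 𝒰 x h) ∧ g = l.prod}
  one_mem' := ⟨[], by simp, by simp⟩
  mul_mem' := by
    rintro _ _ ⟨l, hl, rfl⟩ ⟨m, hm, rfl⟩
    refine ⟨l ++ m, ?_, by rw [List.prod_append]⟩
    intro h hh
    rcases List.mem_append.1 hh with hh | hh
    · exact hl h hh
    · exact hm h hh
  inv_mem' := by
    rintro _ ⟨l, hl, rfl⟩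
    refine ⟨(l.map (·⁻¹)).reverse, ?_, by rw [List.prod_inv_reverse]⟩
    intro h hh
    obtain ⟨g, hg, rfl⟩ := List.mem_map.1 (List.mem_reverse.1 hh)
    exact (hl g hg).inv

variable (X)

/-- The (unbased) Spanier group `π₁ˢᵖ(X, x)`: the intersection of the groups `π(𝒰, x)` over all
open covers `𝒰` of `X`. -/
noncomputable def spanierGroup (x : X) : Subgroup (FundamentalGroup X x) :=
  ⨅ (𝒰 : Set (Set X)) (_ : IsCoverByOpens 𝒰), spanierSubgroup 𝒰 x

/-- `X` is a Spanier space: `π₁ˢᵖ(X, x) = π₁(X, x)` for every point `x`. -/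
def IsSpanierSpace : Prop :=
  ∀ x : X, spanierGroup X x = ⊤

end Spanier

/-!
Write `q : X → X/A` for the quotient map, and let `𝒰` be an open cover of `X/A` with a member `U`
containing the point `q(A)`. The path component `C` of `q⁻¹(U)` that contains `A` is open, because
`X` is locally path connected, and saturated, so `q(C) ⊆ U` is an open neighbourhood of `q(A)`.
By compactness a loop in `X/A` is a finite concatenation of paths each of which lies in `q(C)` or
avoids the point `q(A)`. A path of the second kind lifts to `X`, as `q` restricts to an open
embedding on the complement of the closed set `A`.

Fix a base point `x₀` of `X`. As `X` is simply connected, there is a canonical homotopy class of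
paths in `X/A` from `q(x₀)` to `q(x)` for each point `x` of `X` (`mappedClass`), and conjugating
with these classes turns the class of any path of `X/A` into an element of `π₁(X/A, q(x₀))`. It
suffices to see that this element belongs to the Spanier subgroup of `𝒰` for both kinds of paths
(`ClosesUpIn`). For a path that lifts to `X` the element is trivial
(`closesUpIn_of_lift`): the fibres of `q` are path connected, so the choice of lifted end points
is immaterial. For a path in `q(C)` it is the class of `u * v * u⁻¹` with `v` a loop in `U`
(`closesUpIn_of_forall_mem_image`), since the lifted end points can be joined to a
point of `A` inside `C`. So the Spanier subgroup of `𝒰` is the whole fundamental group.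
-/

open Set Path

/-! ### Closing up paths along the image of a simply connected space -/

section ClosingUp

variable {X Y : Type*} [TopologicalSpace X] [TopologicalSpace Y]

/-- The homotopy class of the image under `f` of a path from `x₀` to `x`. When `X` is simply
connected this does not depend on the path, see `mappedClass_trans_map`. -/
noncomputable def mappedClass [PathConnectedSpace X] (f : C(X, Y)) (x₀ x : X) :
    Homotopic.Quotient (f x₀) (f x) :=
  (Homotopic.Quotient.mk (PathConnectedSpace.somePath x₀ x)).map f

theorem mappedClass_trans_map [SimplyConnectedSpace X] (f : C(X, Y)) {x₀ x x' : X}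
    (δ : Path x x') :
    (mappedClass f x₀ x).trans (Homotopic.Quotient.mk (δ.map f.continuous)) =
      mappedClass f x₀ x' := by
  rw [mappedClass, ← Homotopic.Quotient.mk_map, ← Homotopic.Quotient.mk_trans, ← Path.map_trans]
  exact Homotopic.Quotient.eq.2 ((SimplyConnectedSpace.paths_homotopic _ _).map f)

theorem mappedClass_self [SimplyConnectedSpace X] (f : C(X, Y)) (x₀ : X) :
    mappedClass f x₀ x₀ = Homotopic.Quotient.refl (f x₀) :=
  Homotopic.Quotient.eq.2 ((SimplyConnectedSpace.paths_homotopic _ (Path.refl x₀)).map f)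

/-- The class `c` of paths in `Y` closes up in the subgroup `S` of `π₁(Y, f x₀)`: however the end
points of `c` are lifted to points `x` and `x'` of `X`, the loop that goes from `f x₀` to `f x`
along the image of a path in `X`, follows `c`, and returns from `f x'` along the image of a path
in `X`, has its class in `S`. -/
def ClosesUpIn [PathConnectedSpace X] (f : C(X, Y)) {x₀ : X}
    (S : Subgroup (FundamentalGroup Y (f x₀))) {y y' : Y} (c : Homotopic.Quotient y y') : Prop :=
  ∀ (x x' : X) (h : f x = y) (h' : f x' = y'),
    FundamentalGroup.fromPath ((mappedClass f x₀ x).trans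
      ((c.cast h h').trans (mappedClass f x₀ x').symm)) ∈ S

theorem ClosesUpIn.trans [PathConnectedSpace X] {f : C(X, Y)} (hf : Function.Surjective f) {x₀ : X}
    {S : Subgroup (FundamentalGroup Y (f x₀))} {y₁ y₂ y₃ : Y}
    {c : Homotopic.Quotient y₁ y₂} {d : Homotopic.Quotient y₂ y₃}
    (hc : ClosesUpIn f S c) (hd : ClosesUpIn f S d) : ClosesUpIn f S (c.trans d) := by
  rintro x x' rfl rfl
  obtain ⟨z, rfl⟩ := hf y₂
  -- Multiplication in `FundamentalGroup` is composition of arrows: `p * q` traverses `q` first.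
  have h := S.mul_mem (hd z x' rfl rfl) (hc x z rfl rfl)
  rw [FundamentalGroup.mul_def] at h
  convert h using 1
  change Homotopic.Quotient.trans _ _ =
    Homotopic.Quotient.trans (Homotopic.Quotient.trans _ _) (Homotopic.Quotient.trans _ _)
  simp only [Homotopic.Quotient.cast_rfl_rfl, Homotopic.Quotient.trans_assoc]
  rw [← Homotopic.Quotient.trans_assoc (Homotopic.Quotient.symm _),
    Homotopic.Quotient.symm_trans, Homotopic.Quotient.refl_trans]

/-- If the fibres of `f` are path connected, `mappedClass f x₀ x` depends on `f x` only. -/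
theorem mappedClass_cast [SimplyConnectedSpace X] (f : C(X, Y)) {x₀ x x' : X} (h : f x' = f x)
    (hfib : ∃ δ : Path x x', ∀ t, f (δ t) = f x) :
    (mappedClass f x₀ x).cast rfl h = mappedClass f x₀ x' := by
  obtain ⟨δ, hδ⟩ := hfib
  have hδ' : δ.map f.continuous = (Path.refl (f x)).cast rfl h := by
    ext t
    exact hδ t
  rw [← mappedClass_trans_map f δ, hδ']
  clear hδ' hδ δ
  generalize mappedClass f x₀ x = c
  revert h
  generalize f x' = y
  rintro rfl
  simp

/-- Paths that lift along `f` close up trivially, by simple connectedness. -/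
theorem closesUpIn_of_lift [SimplyConnectedSpace X] {f : C(X, Y)}
    (hfib : ∀ x x', f x = f x' → ∃ δ : Path x x', ∀ t, f (δ t) = f x) {x₀ : X}
    (S : Subgroup (FundamentalGroup Y (f x₀))) {y y' : Y} (p : Path y y') {a b : X}
    (σ : Path a b) (hσ : ∀ t, f (σ t) = p t) : ClosesUpIn f S (Homotopic.Quotient.mk p) := by
  obtain rfl : f a = y := by simpa using hσ 0
  obtain rfl : f b = y' := by simpa using hσ 1
  obtain rfl : σ.map f.continuous = p := by
    ext t
    exact hσ t
  intro x x' h h'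
  rw [← mappedClass_cast f h (hfib a x h.symm), ← mappedClass_cast f h' (hfib b x' h'.symm),
    ← mappedClass_trans_map f σ]
  convert S.one_mem
  rw [FundamentalGroup.one_def]
  generalize Homotopic.Quotient.mk (σ.map f.continuous) = c
  generalize mappedClass f x₀ a = d
  revert h h'
  generalize f x = y
  generalize f x' = y'
  rintro rfl rfl
  simp only [Homotopic.Quotient.cast_rfl_rfl]
  rw [← Homotopic.Quotient.trans_assoc, Homotopic.Quotient.trans_symm]

/-- Paths in the image of a path component `C` of the preimage of a member `U` of the
cover close up in the Spanier subgroup: both ends can be joined within `U` to the image of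
the chosen point of `C`. -/
theorem closesUpIn_of_forall_mem_image {X Y : Type u} [TopologicalSpace X] [TopologicalSpace Y]
    [SimplyConnectedSpace X] {f : C(X, Y)}
    {x₀ : X} {𝒰 : Set (Set Y)} {U : Set Y} (hU : U ∈ 𝒰) {a : X}
    (hsat : ∀ x, f x ∈ f '' pathComponentIn (f ⁻¹' U) a → x ∈ pathComponentIn (f ⁻¹' U) a)
    {y y' : Y} (p : Path y y') (hp : ∀ t, p t ∈ f '' pathComponentIn (f ⁻¹' U) a) :
    ClosesUpIn f (spanierSubgroup 𝒰 (f x₀)) (Homotopic.Quotient.mk p) := by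
  rintro x x' rfl rfl
  obtain ⟨δ, hδ⟩ : JoinedIn (f ⁻¹' U) a x := hsat x (by simpa using hp 0)
  obtain ⟨δ', hδ'⟩ : JoinedIn (f ⁻¹' U) a x' := hsat x' (by simpa using hp 1)
  have hpU : ∀ t, p t ∈ U := fun t => by
    obtain ⟨z, hz, hzt⟩ := hp t
    have hzU : f z ∈ U := pathComponentIn_subset (F := f ⁻¹' U) hz
    exact hzt ▸ hzU
  -- The loop is `u * v * u⁻¹`, where `u` is the image of a path from `x₀` to `a`, and `v` runs from
  -- `f a` to `f x`, along `p` to `f x'`, and back to `f a`.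
  refine ⟨[_], fun g hg => List.mem_singleton.1 hg ▸ ?_, (List.prod_singleton).symm⟩
  refine ⟨f a, (PathConnectedSpace.somePath x₀ a).map f.continuous,
    (δ.map f.continuous).trans (p.trans (δ'.map f.continuous).symm), ⟨U, hU, ?_⟩, ?_⟩
  · rw [← range_subset_iff, Path.trans_range, Path.trans_range, Path.symm_range]
    simp only [union_subset_iff, range_subset_iff]
    exact ⟨hδ, hpU, hδ'⟩
  · rw [← mappedClass_trans_map f δ, ← mappedClass_trans_map f δ']
    have hsymm : ∀ {y₁ y₂ y₃ : Y} (c : Homotopic.Quotient y₁ y₂)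
        (d : Homotopic.Quotient y₂ y₃), (c.trans d).symm = d.symm.trans c.symm := by
      rintro _ _ _ ⟨c⟩ ⟨d⟩
      exact congrArg Homotopic.Quotient.mk (Path.trans_symm c d)
    refine congrArg FundamentalGroup.fromPath ?_
    simp only [hsymm, Homotopic.Quotient.cast_rfl_rfl, Homotopic.Quotient.mk_trans,
      Homotopic.Quotient.mk_symm, Homotopic.Quotient.trans_assoc]
    rfl

/-- A path closes up as soon as it does so locally, by a Lebesgue number argument. -/
theorem closesUpIn_of_isOpen_cover [SimplyConnectedSpace X] {f : C(X, Y)}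
    (hf : Function.Surjective f) {x₀ : X} {S : Subgroup (FundamentalGroup Y (f x₀))}
    (V : Bool → Set Y) (hV : ∀ i, IsOpen (V i)) (hcover : ∀ y, ∃ i, y ∈ V i)
    (hS : ∀ i {y y' : Y} (p : Path y y'), (∀ t, p t ∈ V i) →
      ClosesUpIn f S (Homotopic.Quotient.mk p))
    {y y' : Y} (p : Path y y') : ClosesUpIn f S (Homotopic.Quotient.mk p) := by
  obtain ⟨t, ht0, ht, ⟨n, hn⟩, htV⟩ := exists_monotone_Icc_subset_open_cover_unitInterval
    (fun i => (hV i).preimage p.continuous)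
    (fun s _ => mem_iUnion.2 (hcover (p s)))
  have key : ∀ k, ClosesUpIn f S (Homotopic.Quotient.mk (p.subpath (t 0) (t k))) := by
    intro k
    induction k with
    | zero =>
      obtain ⟨i, hi⟩ := hcover (p (t 0))
      rw [Path.subpath_self]
      exact hS i _ fun _ => hi
    | succ k ih =>
      obtain ⟨i, hi⟩ := htV k
      rw [← Homotopic.Quotient.eq.2 ⟨Path.Homotopy.subpathTransSubpath p (t 0) (t k) (t (k + 1))⟩,
        Homotopic.Quotient.mk_trans]
      refine ih.trans hf (hS i _ ?_)
      rw [← range_subset_iff, Path.range_subpath_of_le _ _ _ (ht k.le_succ)]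
      exact image_subset_iff.2 hi
  intro x x' h h'
  have hk := key n
  rw [ht0, hn n le_rfl, Path.subpath_zero_one] at hk
  exact hk x x' (h.trans p.source.symm) (h'.trans p.target.symm)

end ClosingUp

/-! ### The quotient map collapsing `A` to a point -/

section Collapse

variable {X : Type u} [TopologicalSpace X] (A : Set X)

/-- The quotient map `X → X / A`. -/
def collapseMap : C(X, CollapseSpace A) :=
  ⟨Quotient.mk (collapseSetoid A), continuous_quotient_mk'⟩

variable {A}

theorem collapseMap_surjective : Function.Surjective (collapseMap A) :=
  Quotient.mk_surjective

theorem collapseMap_eq_iff {x y : X} :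
    collapseMap A x = collapseMap A y ↔ x = y ∨ (x ∈ A ∧ y ∈ A) :=
  Quotient.eq (r := collapseSetoid A)

theorem isOpen_image_collapseMap {s : Set X} (hs : IsOpen s)
    (hsat : ∀ x, collapseMap A x ∈ collapseMap A '' s → x ∈ s) : IsOpen (collapseMap A '' s) := by
  have hq : Topology.IsQuotientMap (collapseMap A) := isQuotientMap_quotient_mk'
  rw [← hq.isOpen_preimage]
  convert hs using 1
  exact Subset.antisymm hsat (subset_preimage_image _ _)

theorem mem_of_collapseMap_mem_image_of_subset {s : Set X} (hs : A ⊆ s) (x : X)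
    (hx : collapseMap A x ∈ collapseMap A '' s) : x ∈ s := by
  obtain ⟨z, hz, hzx⟩ := hx
  rcases collapseMap_eq_iff.1 hzx with rfl | h
  exacts [hz, hs h.2]

theorem mem_of_collapseMap_mem_image_of_disjoint {s : Set X} (hs : s ⊆ Aᶜ) (x : X)
    (hx : collapseMap A x ∈ collapseMap A '' s) : x ∈ s := by
  obtain ⟨z, hz, hzx⟩ := hx
  rcases collapseMap_eq_iff.1 hzx with rfl | h
  exacts [hz, absurd h.1 (hs hz)]

theorem isOpenEmbedding_collapseMap_compl (hA : IsClosed A) :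
    Topology.IsOpenEmbedding fun x : (Aᶜ : Set X) => collapseMap A x := by
  refine .of_continuous_injective_isOpenMap (by fun_prop) ?_ ?_
  · intro x y h
    rcases collapseMap_eq_iff.1 h with h | h
    exacts [Subtype.ext h, absurd h.1 x.2]
  · intro s hs
    rw [← Function.comp_def, image_comp]
    refine isOpen_image_collapseMap (hA.isOpen_compl.isOpenMap_subtype_val _ hs)
      (mem_of_collapseMap_mem_image_of_disjoint ?_)
    rintro _ ⟨x, -, rfl⟩
    exact x.2

/-- A path in `X / A` that avoids the collapsed point lifts to `X`. -/
theorem exists_lift_collapseMap (hA : IsClosed A) {y y' : CollapseSpace A} (p : Path y y')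
    (hp : ∀ t, p t ∈ collapseMap A '' Aᶜ) :
    ∃ (a b : X) (σ : Path a b), ∀ t, collapseMap A (σ t) = p t := by
  have he := isOpenEmbedding_collapseMap_compl hA
  choose σ hσ hσp using hp
  have hcont : Continuous fun t => (⟨σ t, hσ t⟩ : (Aᶜ : Set X)) := by
    rw [he.isInducing.continuous_iff]
    convert p.continuous using 1
    exact funext hσp
  exact ⟨σ 0, σ 1, ⟨⟨σ, continuous_subtype_val.comp hcont⟩, rfl, rfl⟩, hσp⟩

theorem exists_path_in_fibre_collapseMap (hA : IsPathConnected A) (x x' : X)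
    (h : collapseMap A x = collapseMap A x') :
    ∃ δ : Path x x', ∀ t, collapseMap A (δ t) = collapseMap A x := by
  rcases collapseMap_eq_iff.1 h with rfl | ⟨hx, hx'⟩
  · exact ⟨Path.refl x, fun _ => rfl⟩
  · obtain ⟨δ, hδ⟩ := hA.joinedIn x hx x' hx'
    exact ⟨δ, fun t => collapseMap_eq_iff.2 (Or.inr ⟨hδ t, hx⟩)⟩

end Collapse

theorem theorem5p5 {X : Type u} [TopologicalSpace X] [FirstCountableTopology X]
    [SimplyConnectedSpace X] [LocallyPathConnectedSpace X]
    (A : Set X) (hA : IsClosed A) (hA' : IsPathConnected A) :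
    IsSpanierSpace (CollapseSpace A) := by
  intro y
  obtain ⟨x₀, rfl⟩ := collapseMap_surjective y
  refine eq_top_iff.2 (le_iInf₂ fun 𝒰 h𝒰 g _ => ?_)
  obtain ⟨a, ha⟩ := hA'.nonempty
  obtain ⟨U, hU, haU⟩ : collapseMap A a ∈ ⋃₀ 𝒰 := h𝒰.2 ▸ mem_univ _
  set C := pathComponentIn (collapseMap A ⁻¹' U) a
  have hAC : A ⊆ C := hA'.subset_pathComponentIn ha fun x hx => by
    rwa [mem_preimage, collapseMap_eq_iff.2 (Or.inr ⟨hx, ha⟩)]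
  have hCopen : IsOpen C := ((h𝒰.1 U hU).preimage (collapseMap A).continuous).pathComponentIn a
  have hCsat := mem_of_collapseMap_mem_image_of_subset hAC
  have hclose : ∀ {y y' : CollapseSpace A} (p : Path y y'),
      ClosesUpIn (collapseMap A) (spanierSubgroup 𝒰 (collapseMap A x₀))
        (Homotopic.Quotient.mk p) := by
    refine closesUpIn_of_isOpen_cover collapseMap_surjective
      (fun i => collapseMap A '' bif i then C else Aᶜ) ?_ ?_ ?_
    · rintro (_ | _)
      · exact isOpen_image_collapseMap hA.isOpen_compl
          (mem_of_collapseMap_mem_image_of_disjoint Subset.rfl)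
      · exact isOpen_image_collapseMap hCopen hCsat
    · intro y
      obtain ⟨x, rfl⟩ := collapseMap_surjective y
      by_cases hx : x ∈ A
      exacts [⟨true, mem_image_of_mem _ (hAC hx)⟩, ⟨false, mem_image_of_mem _ hx⟩]
    · rintro (_ | _) y y' p hp
      · obtain ⟨b, b', σ, hσ⟩ := exists_lift_collapseMap hA p hp
        exact closesUpIn_of_lift (exists_path_in_fibre_collapseMap hA') _ p σ hσ
      · exact closesUpIn_of_forall_mem_image hU hCsat p hp
  obtain ⟨p, rfl⟩ := Homotopic.Quotient.mk_surjective g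
  have h := hclose p x₀ x₀ rfl rfl
  have hrefl : (Homotopic.Quotient.refl (collapseMap A x₀)).symm = Homotopic.Quotient.refl _ :=
    congrArg Homotopic.Quotient.mk Path.refl_symm
  rwa [mappedClass_self, hrefl, Homotopic.Quotient.cast_rfl_rfl, Homotopic.Quotient.trans_refl,
    Homotopic.Quotient.refl_trans] at h
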